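/- Let $n$ and $N$ be the numbers of states and of subsystems of a temporal network $\dot x(t)=A_ix(t)+B_iu_i(t)$, $t\in[t_{i-1},t_i)$, $i=1,\dots,N$, with $x(t)\in\mathbb R^n$, $u_i(t)\in\mathbb R^{m_i}$, of which only the sparsity patterns of $(A_i,B_i)_{i=1}^N$ are given: some entries of $A_i$ and $B_i$ are fixed zeros, and the other ("nonzero") entries are independent real parameters. A realization is an assignment of real values to these parameters. Let $\mathcal G_i$ be the digraph with state vertices $v_1^i,\dots,v_n^i$, input vertices $v^i_{n+1},\dots,v^i_{n+m_i}$, an edge $(v^i_k,v^i_j)$ for each nonzero entry $(j,k)$ of $A_i$, and an edge $(v^i_{n+k},v^i_j)$ for each nonzero entry $(j,k)$ of $B_i$. Let $X=\{v_1,\dots,v_n\}$. A set $V_i\subseteq X$ is covered by a cactus configuration in $\mathcal G_i$ if every vertex of $V_i'=\{v^i_j: v_j\in V_i\}$ can be reached by a path in $\mathcal G_i$ from some input vertex, and $V_i'$ is contained in the vertex set of a collection of vertex-disjoint cycles (self-loops included) and stems of $\mathcal G_i$, a stem being a path from an input vertex with no repeated vertices. Let $C_i=[B_i,A_iB_i,\dots,A_i^{n-1}B_i]$,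 and let $\mathrm{grank}[C_N,C_{N-1},\dots,C_1]$ be the maximum of $\mathrm{rank}[C_N,C_{N-1},\dots,C_1]$ over all realizations. For durations $h_i=t_i-t_{i-1}>0$ let $\Omega_{\{h_i\}}\subseteq\mathbb R^n$ be the subspace of all states $x(t_N)$ that can be reached from $x(t_0)=0$ with piecewise continuous inputs $u_i:[t_{i-1},t_i)\to\mathbb R^{m_i}$, and let $\mathrm{gdim}\,\Omega_{\{h_i\}}$ be the maximum of $\dim\Omega_{\{h_i\}}$ over all realizations and all durations. Suppose that for each $i=1,\dots,N$ the set $V_i\subseteq X$ is covered by a cactus configuration in $\mathcal G_i$. Then $$\Bigl|\bigcup_{i=1}^N V_i\Bigr|\;\le\;\mathrm{grank}[C_N,C_{N-1},\dots,C_1]\;\le\;\mathrm{gdim}\,\Omega_{\{h_i\}} .$$ -/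

import Mathlib

open Set Filter Topology

noncomputable section

/-- The sparsity patterns of the subsystem matrices `(A_i, B_i)`, `i = 1, …, N`, of a temporal
network with `n` states and `m i` inputs in the `i`-th subsystem. `A i j k` says that the entry
`(j, k)` of `A_i` is a nonzero (that is, indeterminate) entry; all other entries are fixed zeros.
Similarly for `B`. -/
structure TemporalPattern (N n : ℕ) (m : Fin N → ℕ) where
  A : (i : Fin N) → Fin n → Fin n → Prop
  B : (i : Fin N) → Fin n → Fin (m i) → Prop

/-- Numerical matrices `(A_i, B_i)`, `i = 1, …, N`. -/
structure TemporalSystem (N n : ℕ) (m : Fin N → ℕ) where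
  A : (i : Fin N) → Matrix (Fin n) (Fin n) ℝ
  B : (i : Fin N) → Matrix (Fin n) (Fin (m i)) ℝ

/-- `S` is a realization of the pattern `P`: the fixed zeros are preserved, the other entries take
arbitrary real values (zero included), independently of each other. -/
def TemporalPattern.IsRealization {N n : ℕ} {m : Fin N → ℕ} (P : TemporalPattern N n m)
    (S : TemporalSystem N n m) : Prop :=
  (∀ i j k, ¬ P.A i j k → S.A i j k = 0) ∧ (∀ i j k, ¬ P.B i j k → S.B i j k = 0)

/-! ### System digraphs and cactus configurations -/

/-- The digraph of the `i`-th subsystem. The state vertex `v_j` is `Sum.inl j`, the `k`-th input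
vertex is `Sum.inr k`; `(v_k, v_j)` is an edge iff `A_{i,jk} ≠ 0`, and there is an edge from the
`k`-th input vertex to `v_j` iff `B_{i,jk} ≠ 0`. -/
def TemporalPattern.digraph {N n : ℕ} {m : Fin N → ℕ} (P : TemporalPattern N n m) (i : Fin N) :
    Digraph (Fin n ⊕ Fin (m i)) where
  Adj := fun v w => match v, w with
    | Sum.inl k, Sum.inl j => P.A i j k
    | Sum.inr k, Sum.inl j => P.B i j k
    | _, Sum.inr _ => False

/-- There is a path from some input vertex to the state vertex `v_j`. -/
def InputReachable {n m : ℕ} (G : Digraph (Fin n ⊕ Fin m)) (j : Fin n) : Prop :=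
  ∃ k : Fin m, Relation.ReflTransGen G.Adj (Sum.inr k) (Sum.inl j)

/-- A stem: a path from an input vertex with no repeated vertices, given by its vertices. -/
def IsStem {n m : ℕ} (G : Digraph (Fin n ⊕ Fin m)) (p : List (Fin n ⊕ Fin m)) : Prop :=
  (∃ (k : Fin m) (q : List (Fin n ⊕ Fin m)), p = Sum.inr k :: q) ∧
    p.IsChain G.Adj ∧ p.Nodup

/-- A cycle `(v, …, w, v)`, given by the list `[v, …, w]` of its vertices, which are distinct.
A self-loop `(v, v)` is a cycle. -/
def IsCycle {n m : ℕ} (G : Digraph (Fin n ⊕ Fin m)) (p : List (Fin n ⊕ Fin m)) : Prop :=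
  (∃ (v : Fin n ⊕ Fin m) (q : List (Fin n ⊕ Fin m)),
    p = v :: q ∧ (v :: (q ++ [v])).IsChain G.Adj) ∧ p.Nodup

/-- The set `V` of state vertices is covered by a cactus configuration in `G`: every vertex of `V`
is input-reachable, and `V` is contained in the set of vertices of a collection of vertex-disjoint
cycles and stems. -/
def CoveredByCactus {n m : ℕ} (G : Digraph (Fin n ⊕ Fin m)) (V : Finset (Fin n)) : Prop :=
  (∀ j ∈ V, InputReachable G j) ∧
    ∃ F : Set (List (Fin n ⊕ Fin m)),
      (∀ p ∈ F, IsCycle G p ∨ IsStem G p) ∧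
      F.Pairwise List.Disjoint ∧
      ∀ j ∈ V, ∃ p ∈ F, Sum.inl j ∈ p

/-! ### Controllability matrices and the generic rank -/

/-- The controllability matrix `[B, AB, …, A^{n-1}B]`; its column `(t, k)` is the `k`-th column of
`A^t B`. -/
def ctrbMatrix {n m : ℕ} (A : Matrix (Fin n) (Fin n) ℝ) (B : Matrix (Fin n) (Fin m) ℝ) :
    Matrix (Fin n) (Fin n × Fin m) ℝ :=
  Matrix.of fun r c => (A ^ (c.1 : ℕ) * B) r c.2

/-- The matrix `[C_N, C_{N-1}, …, C_1]`, where `C_i` is the controllability matrix of `(A_i, B_i)`.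
The block index is the first component of the column index. -/
def TemporalSystem.lowMatrix {N n : ℕ} {m : Fin N → ℕ} (S : TemporalSystem N n m) :
    Matrix (Fin n) ((i : Fin N) × (Fin n × Fin (m i))) ℝ :=
  Matrix.of fun r c => ctrbMatrix (S.A c.1) (S.B c.1) r c.2

/-- The generic rank of `[C_N, …, C_1]`: the maximum of its rank over all realizations (a maximum
over a nonempty set of numbers that are at most `n`). -/
def TemporalPattern.grankLow {N n : ℕ} {m : Fin N → ℕ} (P : TemporalPattern N n m) : ℕ :=
  sSup {r : ℕ | ∃ S : TemporalSystem N n m, P.IsRealization S ∧ r = S.lowMatrix.rank}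

/-! ### Reachable subspace on a temporal sequence and its generic dimension -/

/-- `u` is piecewise continuous on `[a, b)`: it is continuous there outside a finite set, and it has
all one-sided limits. -/
def PiecewiseContinuousOn {m : ℕ} (u : ℝ → Fin m → ℝ) (a b : ℝ) : Prop :=
  (∃ D : Set ℝ, D.Finite ∧ ContinuousOn u (Ico a b \ D)) ∧
    (∀ s ∈ Ico a b, ∃ l, Tendsto u (𝓝[>] s) (𝓝 l)) ∧
    (∀ s ∈ Ioc a b, ∃ l, Tendsto u (𝓝[<] s) (𝓝 l))

/-- `x` is a trajectory, on the temporal sequence `[t_0, t_1), …, [t_{N-1}, t_N)`, under the inputs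
`u_i`: it is continuous, and on the `i`-th interval `x' = A_i x + B_i u_i` outside a finite set.
With zero-based indices, the `i`-th interval is `[t i.castSucc, t i.succ)`. -/
def TemporalSystem.IsTrajectory {N n : ℕ} {m : Fin N → ℕ} (S : TemporalSystem N n m)
    (t : Fin (N + 1) → ℝ) (u : (i : Fin N) → ℝ → Fin (m i) → ℝ) (x : ℝ → Fin n → ℝ) : Prop :=
  ContinuousOn x (Icc (t 0) (t (Fin.last N))) ∧
    ∀ i : Fin N, ∃ D : Set ℝ, D.Finite ∧ ∀ s ∈ Ioo (t i.castSucc) (t i.succ) \ D,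
      HasDerivAt x ((S.A i).mulVec (x s) + (S.B i).mulVec (u i s)) s

/-- The state `y` is reachable on the temporal sequence `t`. -/
def TemporalSystem.IsReachable {N n : ℕ} {m : Fin N → ℕ} (S : TemporalSystem N n m)
    (t : Fin (N + 1) → ℝ) (y : Fin n → ℝ) : Prop :=
  ∃ (u : (i : Fin N) → ℝ → Fin (m i) → ℝ) (x : ℝ → Fin n → ℝ),
    (∀ i, PiecewiseContinuousOn (u i) (t i.castSucc) (t i.succ)) ∧
      S.IsTrajectory t u x ∧ x (t 0) = 0 ∧ x (t (Fin.last N)) = y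

/-- The reachable set on the temporal sequence `t`, which is a subspace of `ℝⁿ`. -/
def TemporalSystem.reachableSubspace {N n : ℕ} {m : Fin N → ℕ} (S : TemporalSystem N n m)
    (t : Fin (N + 1) → ℝ) : Submodule ℝ (Fin n → ℝ) where
  carrier := {y | S.IsReachable t y}
  zero_mem' := by
    refine ⟨fun _ _ => 0, fun _ => 0, fun i => ⟨⟨∅, Set.finite_empty, continuousOn_const⟩,
      fun s _ => ⟨0, tendsto_const_nhds⟩, fun s _ => ⟨0, tendsto_const_nhds⟩⟩,
      ⟨continuousOn_const, fun i => ⟨∅, Set.finite_empty, fun s _ => ?_⟩⟩, rfl, rfl⟩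
    simpa using hasDerivAt_const s (0 : Fin n → ℝ)
  add_mem' := by
    rintro y z ⟨u, x, hu, ⟨hxc, hx⟩, hx0, hxN⟩ ⟨v, w, hv, ⟨hwc, hw⟩, hw0, hwN⟩
    refine ⟨fun i s => u i s + v i s, fun s => x s + w s, fun i => ⟨?_, ?_, ?_⟩,
      ⟨hxc.add hwc, fun i => ?_⟩, by simp [hx0, hw0], by simp [hxN, hwN]⟩
    · obtain ⟨D, hD, hc⟩ := (hu i).1
      obtain ⟨D', hD', hc'⟩ := (hv i).1
      refine ⟨D ∪ D', hD.union hD', ?_⟩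
      exact (hc.mono (sdiff_subset_sdiff_right subset_union_left)).add
        (hc'.mono (sdiff_subset_sdiff_right subset_union_right))
    · intro s hs
      obtain ⟨l, hl⟩ := (hu i).2.1 s hs
      obtain ⟨l', hl'⟩ := (hv i).2.1 s hs
      exact ⟨l + l', hl.add hl'⟩
    · intro s hs
      obtain ⟨l, hl⟩ := (hu i).2.2 s hs
      obtain ⟨l', hl'⟩ := (hv i).2.2 s hs
      exact ⟨l + l', hl.add hl'⟩
    · obtain ⟨D, hD, hd⟩ := hx i
      obtain ⟨D', hD', hd'⟩ := hw i
      refine ⟨D ∪ D', hD.union hD', fun s hs => ?_⟩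
      have h1 := hd s ⟨hs.1, fun h => hs.2 (Or.inl h)⟩
      have h2 := hd' s ⟨hs.1, fun h => hs.2 (Or.inr h)⟩
      have h3 := h1.add h2
      rw [Matrix.mulVec_add, Matrix.mulVec_add]
      rw [add_add_add_comm] at h3
      exact h3
  smul_mem' := by
    rintro c y ⟨u, x, hu, ⟨hxc, hx⟩, hx0, hxN⟩
    refine ⟨fun i s => c • u i s, fun s => c • x s, fun i => ⟨?_, ?_, ?_⟩,
      ⟨hxc.const_smul c, fun i => ?_⟩, by simp [hx0], by simp [hxN]⟩
    · obtain ⟨D, hD, hc⟩ := (hu i).1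
      exact ⟨D, hD, hc.const_smul c⟩
    · intro s hs
      obtain ⟨l, hl⟩ := (hu i).2.1 s hs
      exact ⟨c • l, hl.const_smul c⟩
    · intro s hs
      obtain ⟨l, hl⟩ := (hu i).2.2 s hs
      exact ⟨c • l, hl.const_smul c⟩
    · obtain ⟨D, hD, hd⟩ := hx i
      refine ⟨D, hD, fun s hs => ?_⟩
      have h1 := (hd s hs).const_smul c
      rw [Matrix.mulVec_smul, Matrix.mulVec_smul, ← smul_add]
      exact h1

/-- The generic dimension of the reachable subspace: the maximum of its dimension over all
realizations and all temporal sequences `t_0 < t_1 < ⋯ < t_N` (a maximum over a nonempty set of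
numbers that are at most `n`). -/
def TemporalPattern.gdimReachable {N n : ℕ} {m : Fin N → ℕ} (P : TemporalPattern N n m) : ℕ :=
  sSup {r : ℕ | ∃ (S : TemporalSystem N n m) (t : Fin (N + 1) → ℝ),
    P.IsRealization S ∧ StrictMono t ∧ r = Module.finrank ℝ (S.reachableSubspace t)}

end

/-! Right inequality: fix a realization and let all durations equal `h → 0`. A column of `C_i` is
reachable during interval `i` from the zero state, and the later intervals move it by flows
`e^{hA_j}`, which tend to the identity. Independent columns of `[C_N, …, C_1]` are thus limits of
reachable states, and linear independence is an open condition.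

Left inequality, one subsystem: encode the row of a vertex `v` in `[B, AB, …]` as the vector of
power series `g_v = ∑ (A^t B)_v X^(t+1)`, so that `g_v = X ∑ weight(v,u) g_u`, with basis vectors at
the inputs. Along stems the `g_v` are distinct monomials `X^d e_k`. A cycle of length `l` fed by
`p`, with weight `c` on its closing edge, has the series `X^r / (1 - c X^l) · X g_p`. These are
independent over all `(r, c)`, so for some `c` their span avoids the finite-dimensional span built
so far. Vertices outside the cactus merely relay a nonzero signal. Growing the vertex set to a
maximal one exhausts everything input-reachable, and Cayley-Hamilton truncates to `t < n`.

All subsystems: assign to each vertex of the union one subsystem covering it. A diagonal similarity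
preserves the pattern and scales row `v` of `C_i` by `1` if `v` is assigned to `i` and by `ε`
otherwise. At `ε = 0` the assigned rows are block diagonal, hence independent, and they stay so for
some `ε ≠ 0`. -/

noncomputable section

/-! ### Reachability within one subsystem -/

section VariationOfConstants

variable {n m : ℕ} (A : Matrix (Fin n) (Fin n) ℝ) (B : Matrix (Fin n) (Fin m) ℝ)

/-- The flow `y ↦ e^{sA} y` of the linear differential equation `x' = A x`. -/
def linearFlow (s : ℝ) : (Fin n → ℝ) →L[ℝ] (Fin n → ℝ) :=
  NormedSpace.exp (s • LinearMap.toContinuousLinearMap (Matrix.toLin' A))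

theorem linearFlow_zero : linearFlow A 0 = 1 := by
  simp [linearFlow, NormedSpace.exp_zero]

theorem linearFlow_add (s t : ℝ) : linearFlow A (s + t) = linearFlow A s * linearFlow A t := by
  let := NormedAlgebra.restrictScalars ℚ ℝ ((Fin n → ℝ) →L[ℝ] (Fin n → ℝ))
  rw [linearFlow, add_smul, NormedSpace.exp_add_of_commute]
  · rfl
  · exact ((Commute.refl _).smul_left s).smul_right t

theorem hasDerivAt_linearFlow (s : ℝ) : HasDerivAt (linearFlow A)
    (linearFlow A s * LinearMap.toContinuousLinearMap (Matrix.toLin' A)) s :=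
  hasDerivAt_exp_smul_const (LinearMap.toContinuousLinearMap (Matrix.toLin' A)) s

theorem hasDerivAt_linearFlow_left (s : ℝ) : HasDerivAt (linearFlow A)
    (LinearMap.toContinuousLinearMap (Matrix.toLin' A) * linearFlow A s) s :=
  hasDerivAt_exp_smul_const' (LinearMap.toContinuousLinearMap (Matrix.toLin' A)) s

theorem continuous_linearFlow : Continuous (linearFlow A) :=
  continuous_iff_continuousAt.2 fun s => (hasDerivAt_linearFlow A s).continuousAt

theorem hasDerivAt_linearFlow_apply (s : ℝ) (y : Fin n → ℝ) :
    HasDerivAt (fun s => linearFlow A s y) (linearFlow A s (A.mulVec y)) s := by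
  simpa using (hasDerivAt_linearFlow A s).clm_apply (hasDerivAt_const s y)

/-- The solution of `x' = A x + B u`, `x a = y`, by variation of constants. -/
def forcedSolution (a : ℝ) (y : Fin n → ℝ) (u : ℝ → Fin m → ℝ) (s : ℝ) : Fin n → ℝ :=
  linearFlow A (s - a) (y + ∫ τ in a..s, linearFlow A (a - τ) (B.mulVec (u τ)))

theorem continuous_linearFlow_mulVec (a : ℝ) {u : ℝ → Fin m → ℝ} (hu : Continuous u) :
    Continuous fun τ => linearFlow A (a - τ) (B.mulVec (u τ)) := by
  have h1 : Continuous fun τ => linearFlow A (a - τ) :=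
    (continuous_linearFlow A).comp (continuous_const.sub continuous_id)
  exact h1.clm_apply (Continuous.matrix_mulVec continuous_const hu)

theorem hasDerivAt_forcedSolution (a : ℝ) (y : Fin n → ℝ) {u : ℝ → Fin m → ℝ}
    (hu : Continuous u) (s : ℝ) :
    HasDerivAt (forcedSolution A B a y u)
      (A.mulVec (forcedSolution A B a y u s) + B.mulVec (u s)) s := by
  have h1 : HasDerivAt (fun s => linearFlow A (s - a))
      (LinearMap.toContinuousLinearMap (Matrix.toLin' A) * linearFlow A (s - a)) s := by
    simpa using (hasDerivAt_linearFlow_left A (s - a)).comp_sub_const s a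
  have h2 : HasDerivAt (fun s => y + ∫ τ in a..s, linearFlow A (a - τ) (B.mulVec (u τ)))
      (linearFlow A (a - s) (B.mulVec (u s))) s :=
    ((continuous_linearFlow_mulVec A B a hu).integral_hasStrictDerivAt a s).hasDerivAt.const_add y
  have h3 := h1.clm_apply h2
  have h4 : linearFlow A (s - a) (linearFlow A (a - s) (B.mulVec (u s))) = B.mulVec (u s) := by
    rw [← mul_apply_eq_comp, ← linearFlow_add]
    simp [linearFlow_zero]
  rw [h4] at h3
  exact h3

theorem forcedSolution_self (a : ℝ) (y : Fin n → ℝ) (u : ℝ → Fin m → ℝ) :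
    forcedSolution A B a y u a = y := by
  simp [forcedSolution, linearFlow_zero]

theorem forcedSolution_zero_input (a : ℝ) (y : Fin n → ℝ) (s : ℝ) :
    forcedSolution A B a y 0 s = linearFlow A (s - a) y := by
  simp [forcedSolution]

theorem forcedSolution_zero (a s : ℝ) {u : ℝ → Fin m → ℝ} (hu : Continuous u) :
    forcedSolution A B a 0 u s = ∫ τ in a..s, linearFlow A (s - τ) (B.mulVec (u τ)) := by
  rw [forcedSolution, zero_add, ← ContinuousLinearMap.intervalIntegral_comp_comm _
    ((continuous_linearFlow_mulVec A B a hu).intervalIntegrable a s)]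
  congr 1
  funext τ
  rw [← mul_apply_eq_comp, ← linearFlow_add]
  congr 2
  ring

/-- The states reachable from `0` on `[a, b]` with continuous inputs. -/
def forcedReachable (a b : ℝ) : Submodule ℝ (Fin n → ℝ) where
  carrier := {y | ∃ u : ℝ → Fin m → ℝ, Continuous u ∧ forcedSolution A B a 0 u b = y}
  zero_mem' := ⟨0, continuous_const, by simp [forcedSolution_zero_input]⟩
  add_mem' := by
    rintro y z ⟨u, hu, rfl⟩ ⟨v, hv, rfl⟩
    refine ⟨u + v, hu.add hv, ?_⟩
    rw [forcedSolution_zero A B a b hu, forcedSolution_zero A B a b hv,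
      forcedSolution_zero A B a b (hu.add hv), ← intervalIntegral.integral_add
      ((continuous_linearFlow_mulVec A B b hu).intervalIntegrable a b)
      ((continuous_linearFlow_mulVec A B b hv).intervalIntegrable a b)]
    simp [Matrix.mulVec_add]
  smul_mem' := by
    rintro c y ⟨u, hu, rfl⟩
    refine ⟨c • u, hu.const_smul c, ?_⟩
    rw [forcedSolution_zero A B a b hu, forcedSolution_zero A B a b (hu.const_smul c),
      ← intervalIntegral.integral_smul]
    simp [Matrix.mulVec_smul]

/-- If a functional vanishes on `e^{sA} b` for all `s` in an interval, then it does so on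
`e^{sA} A b`. -/
theorem linearFlow_orthogonal_mulVec {h : ℝ} (hh : 0 < h) (f : (Fin n → ℝ) →L[ℝ] ℝ)
    {b : Fin n → ℝ} (hb : ∀ s ∈ Icc 0 h, f (linearFlow A s b) = 0) :
    ∀ s ∈ Icc 0 h, f (linearFlow A s (A.mulVec b)) = 0 := by
  intro s hs
  have h1 : HasDerivWithinAt (fun s => f (linearFlow A s b)) (f (linearFlow A s (A.mulVec b)))
      (Icc 0 h) s :=
    (f.hasFDerivAt.comp_hasDerivAt s (hasDerivAt_linearFlow_apply A s b)).hasDerivWithinAt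
  have h2 : HasDerivWithinAt (fun s => f (linearFlow A s b)) 0 (Icc 0 h) s :=
    (hasDerivWithinAt_const s (Icc 0 h) (0 : ℝ)).congr hb (hb s hs)
  exact (uniqueDiffOn_Icc hh s hs).eq_deriv _ h1 h2

theorem linearFlow_orthogonal_pow {h : ℝ} (hh : 0 < h) (f : (Fin n → ℝ) →L[ℝ] ℝ)
    {b : Fin n → ℝ} (hb : ∀ s ∈ Icc 0 h, f (linearFlow A s b) = 0) (j : ℕ) :
    ∀ s ∈ Icc 0 h, f (linearFlow A s ((A ^ j).mulVec b)) = 0 := by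
  induction j with
  | zero => simpa using hb
  | succ j ih =>
    have := linearFlow_orthogonal_mulVec A hh f ih
    simpa [Matrix.mulVec_mulVec, ← pow_succ'] using this

/-- The columns of the controllability matrix are reachable in any positive time. -/
theorem pow_mulVec_mem_forcedReachable {a b : ℝ} (hab : a < b) (j : ℕ) (k : Fin m) :
    (A ^ j).mulVec (B.col k) ∈ forcedReachable A B a b := by
  by_contra hc
  obtain ⟨f, hfc, hf⟩ := Submodule.exists_le_ker_of_notMem hc
  apply hfc
  set F : (Fin n → ℝ) →L[ℝ] ℝ := LinearMap.toContinuousLinearMap f with hF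
  set φ : ℝ → ℝ := fun τ => F (linearFlow A (b - τ) (B.col k)) with hφ
  have hφc : Continuous φ := F.continuous.comp
    (((continuous_linearFlow A).comp (continuous_const.sub continuous_id)).clm_apply
      continuous_const)
  -- With the functional's own response as input, its value at the final state is `∫ φ²`, so `φ`
  -- vanishes; its derivatives at `τ = b` are, up to sign, the values of `f` on `A^j b_k`.
  set u : ℝ → Fin m → ℝ := fun τ => φ τ • Pi.single k 1 with hu
  have huc : Continuous u := hφc.smul continuous_const
  have h0 : F (forcedSolution A B a 0 u b) = 0 := hf ⟨u, huc, rfl⟩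
  rw [forcedSolution_zero A B a b huc, ← ContinuousLinearMap.intervalIntegral_comp_comm _
    ((continuous_linearFlow_mulVec A B b huc).intervalIntegrable a b)] at h0
  have h1 : ∀ τ, F (linearFlow A (b - τ) (B.mulVec (u τ))) = φ τ ^ 2 := by
    intro τ
    rw [hu, Matrix.mulVec_smul, map_smul, map_smul, Matrix.mulVec_single_one, smul_eq_mul, sq]
  simp only [h1] at h0
  have h2 : ∀ τ ∈ Icc a b, φ τ = 0 := by
    intro τ hτ
    by_contra hne
    have : 0 < ∫ τ in a..b, φ τ ^ 2 :=
      intervalIntegral.integral_pos hab (hφc.pow 2).continuousOn (fun _ _ => sq_nonneg _)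
        ⟨τ, hτ, by positivity⟩
    exact this.ne' h0
  have h3 : ∀ s ∈ Icc 0 (b - a), F (linearFlow A s (B.col k)) = 0 := by
    intro s hs
    have := h2 (b - s) ⟨by linarith [hs.2], by linarith [hs.1]⟩
    simpa [hφ] using this
  have h4 := linearFlow_orthogonal_pow A (sub_pos.2 hab) F h3 j 0 ⟨le_rfl, by linarith⟩
  simpa [linearFlow_zero, hF] using h4

end VariationOfConstants

/-! ### Reachability on temporal sequences with short durations -/

theorem Continuous.piecewiseContinuousOn {m : ℕ} {u : ℝ → Fin m → ℝ} (hu : Continuous u)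
    (a b : ℝ) : PiecewiseContinuousOn u a b :=
  ⟨⟨∅, Set.finite_empty, hu.continuousOn⟩,
    fun s _ => ⟨u s, (hu.tendsto s).mono_left nhdsWithin_le_nhds⟩,
    fun s _ => ⟨u s, (hu.tendsto s).mono_left nhdsWithin_le_nhds⟩⟩

namespace TemporalSystem

variable {N n : ℕ} {m : Fin N → ℕ} (S : TemporalSystem N n m) (t : Fin (N + 1) → ℝ)

/-- The state `y` is reachable at time `t j` with continuous inputs. -/
def ReachableAt (j : Fin (N + 1)) (y : Fin n → ℝ) : Prop :=
  ∃ (u : (i : Fin N) → ℝ → Fin (m i) → ℝ) (x : ℝ → Fin n → ℝ),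
    (∀ i, Continuous (u i)) ∧ ContinuousOn x (Icc (t 0) (t j)) ∧
      (∀ i : Fin N, i.succ ≤ j → ∀ s ∈ Ioo (t i.castSucc) (t i.succ),
        HasDerivAt x ((S.A i).mulVec (x s) + (S.B i).mulVec (u i s)) s) ∧
      x (t 0) = 0 ∧ x (t j) = y

variable {S t}

theorem ReachableAt.isReachable {y : Fin n → ℝ} (h : S.ReachableAt t (Fin.last N) y) :
    S.IsReachable t y := by
  obtain ⟨u, x, hu, hxc, hx, h0, h1⟩ := h
  exact ⟨u, x, fun i => (hu i).piecewiseContinuousOn _ _,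
    ⟨hxc, fun i => ⟨∅, Set.finite_empty, fun s hs => hx i (Fin.le_last _) s hs.1⟩⟩, h0, h1⟩

theorem reachableAt_zero : S.ReachableAt t 0 0 :=
  ⟨fun _ _ => 0, fun _ => 0, fun _ => continuous_const, continuousOn_const,
    fun i hi => absurd hi (by simp), rfl, rfl⟩

/-- Trajectories are glued at `t i.castSucc`; a corner there is harmless, since the equation is
required on open intervals only. -/
theorem ReachableAt.succ (ht : StrictMono t) {i : Fin N} {y : Fin n → ℝ}
    (h : S.ReachableAt t i.castSucc y) {v : ℝ → Fin (m i) → ℝ} (hv : Continuous v) :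
    S.ReachableAt t i.succ
      (forcedSolution (S.A i) (S.B i) (t i.castSucc) y v (t i.succ)) := by
  obtain ⟨u, x, hu, hxc, hx, h0, h1⟩ := h
  have hlt : t i.castSucc < t i.succ := ht i.castSucc_lt_succ
  have h0le : t 0 ≤ t i.castSucc := ht.monotone (Fin.zero_le _)
  set z := forcedSolution (S.A i) (S.B i) (t i.castSucc) y v with hz
  have hzd := hasDerivAt_forcedSolution (S.A i) (S.B i) (t i.castSucc) y hv
  have hzc : Continuous z := continuous_iff_continuousAt.2 fun s => (hzd s).continuousAt
  have hzy : z (t i.castSucc) = y := forcedSolution_self ..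
  refine ⟨Function.update u i v, fun s => if s ≤ t i.castSucc then x s else z s, ?_, ?_, ?_, ?_, ?_⟩
  · intro j
    rcases eq_or_ne j i with rfl | hj
    · simpa using hv
    · simpa [Function.update_of_ne hj] using hu j
  · rw [← Icc_union_Icc_eq_Icc h0le hlt.le]
    refine ContinuousOn.union_of_isClosed ?_ ?_ isClosed_Icc isClosed_Icc
    · exact hxc.congr fun s hs => if_pos hs.2
    · refine hzc.continuousOn.congr fun s hs => ?_
      rcases hs.1.eq_or_lt with rfl | hs'
      · simp [hzy, h1]
      · exact if_neg (not_le.2 hs')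
  · intro j hj s hs
    rcases eq_or_ne j i with rfl | hji
    · have hev : (fun s => if s ≤ t j.castSucc then x s else z s) =ᶠ[𝓝 s] z := by
        filter_upwards [Ioi_mem_nhds hs.1] with r hr using if_neg (not_le.2 hr)
      simp only [if_neg (not_le.2 hs.1), Function.update_self]
      exact (hzd s).congr_of_eventuallyEq hev
    · have hlt' : j < i := lt_of_le_of_ne (Fin.succ_le_succ_iff.1 hj) hji
      have hle : j.succ ≤ i.castSucc := by
        rw [Fin.le_def]; simpa using hlt'
      have hs' : s < t i.castSucc := hs.2.trans_le (ht.monotone hle)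
      have hev : (fun s => if s ≤ t i.castSucc then x s else z s) =ᶠ[𝓝 s] x := by
        filter_upwards [Iio_mem_nhds hs'] with r hr using if_pos (le_of_lt hr)
      simp only [if_pos hs'.le, Function.update_of_ne hji]
      exact (hx j hle s hs).congr_of_eventuallyEq hev
  · simp [h0le, h0]
  · simp [hlt]

theorem ReachableAt.succ_flow (ht : StrictMono t) {i : Fin N} {y : Fin n → ℝ}
    (h : S.ReachableAt t i.castSucc y) :
    S.ReachableAt t i.succ (linearFlow (S.A i) (t i.succ - t i.castSucc) y) := by
  have := h.succ ht (v := 0) continuous_const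
  rwa [forcedSolution_zero_input] at this

theorem reachableAt_zero_state (ht : StrictMono t) (j : Fin (N + 1)) : S.ReachableAt t j 0 := by
  induction j using Fin.induction with
  | zero => exact reachableAt_zero
  | succ i ih => simpa using ih.succ_flow ht

variable (S)

theorem col_lowMatrix (c : (i : Fin N) × (Fin n × Fin (m i))) :
    S.lowMatrix.col c = ((S.A c.1) ^ (c.2.1 : ℕ)).mulVec ((S.B c.1).col c.2.2) := by
  ext r
  simp [lowMatrix, ctrbMatrix, Matrix.mul_apply, Matrix.mulVec, dotProduct]

/-- Every column of `[C_N, …, C_1]` is a limit of states that are reachable on temporal sequences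
whose durations tend to zero. -/
theorem exists_tendsto_reachableAt (c : (i : Fin N) × (Fin n × Fin (m i))) (j : Fin (N + 1))
    (hj : c.1.succ ≤ j) :
    ∃ y : ℝ → Fin n → ℝ, Tendsto y (𝓝[>] 0) (𝓝 (S.lowMatrix.col c)) ∧
      ∀ h > 0, S.ReachableAt (fun i => (i : ℝ) * h) j (y h) := by
  induction j using Fin.induction with
  | zero => exact absurd hj (by simp)
  | succ i ih =>
    have hmono : ∀ h : ℝ, 0 < h → StrictMono fun i : Fin (N + 1) => (i : ℝ) * h := by
      intro h hh i j hij
      exact mul_lt_mul_of_pos_right (by exact_mod_cast hij) hh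
    by_cases hi : c.1 = i
    -- Resting at `0` before interval `c.1` and steering during it reaches the column exactly, for
    -- every `h`.
    · refine ⟨fun _ => S.lowMatrix.col c, tendsto_const_nhds, fun h hh => ?_⟩
      subst hi
      obtain ⟨v, hv, hvc⟩ := pow_mulVec_mem_forcedReachable (S.A c.1) (S.B c.1)
        (hmono h hh c.1.castSucc_lt_succ) c.2.1 c.2.2
      rw [col_lowMatrix, ← hvc]
      exact (reachableAt_zero_state (hmono h hh) _).succ (hmono h hh) hv
    · have hlt : c.1 < i := lt_of_le_of_ne (Fin.succ_le_succ_iff.1 hj) hi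
      have hle : c.1.succ ≤ i.castSucc := by
        rw [Fin.le_def]; simpa using hlt
      obtain ⟨y, hy, hyr⟩ := ih hle
      refine ⟨fun h => linearFlow (S.A i) h (y h), ?_, fun h hh => ?_⟩
      · have h1 : Tendsto (linearFlow (S.A i)) (𝓝[>] 0) (𝓝 1) := by
          have := (continuous_linearFlow (S.A i)).tendsto 0
          rw [linearFlow_zero] at this
          exact this.mono_left nhdsWithin_le_nhds
        simpa [Function.comp_def] using
          (isBoundedBilinearMap_apply.continuous.tendsto (1, S.lowMatrix.col c)).comp
          (h1.prodMk_nhds hy)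
      · have := (hyr h hh).succ_flow (hmono h hh)
        have e : ((i.succ : Fin (N + 1)) : ℝ) * h - ((i.castSucc : Fin (N + 1)) : ℝ) * h = h := by
          simp; ring
        simpa only [e] using this

/-- On a suitable temporal sequence the dimension of the reachable subspace is at least the rank of
`[C_N, …, C_1]`. -/
theorem exists_rank_le_finrank_reachableSubspace :
    ∃ t : Fin (N + 1) → ℝ, StrictMono t ∧
      S.lowMatrix.rank ≤ Module.finrank ℝ (S.reachableSubspace t) := by
  obtain ⟨κ, a, -, hspan, hli⟩ := exists_linearIndependent' ℝ S.lowMatrix.col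
  have : Finite κ := hli.finite
  have : Fintype κ := Fintype.ofFinite κ
  choose y hy hyr using fun k => S.exists_tendsto_reachableAt (a k) (Fin.last N) (Fin.le_last _)
  have h1 : Tendsto (fun h k => y k h) (𝓝[>] 0) (𝓝 (S.lowMatrix.col ∘ a)) :=
    tendsto_pi_nhds.2 fun k => hy k
  -- Independence of a finite family is open, so it passes from the limit to small `h`.
  have h2 : ∀ᶠ h in 𝓝[>] (0 : ℝ), LinearIndependent ℝ (fun k => y k h) :=
    h1.eventually (isOpen_setOfPred_linearIndependent.mem_nhds hli)
  obtain ⟨h, hh, hpos⟩ := (h2.and self_mem_nhdsWithin).exists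
  refine ⟨fun i => (i : ℝ) * h, fun i j hij =>
    mul_lt_mul_of_pos_right (by exact_mod_cast hij) hpos, ?_⟩
  rw [Matrix.rank_eq_finrank_span_cols, ← hspan, finrank_span_eq_card hli]
  have h3 : LinearIndependent ℝ (fun k => (⟨y k h, (hyr k h hpos).isReachable⟩ :
      S.reachableSubspace fun i : Fin (N + 1) => (i : ℝ) * h)) :=
    LinearIndependent.of_comp (Submodule.subtype _) hh
  exact h3.fintype_card_le_finrank

end TemporalSystem

theorem TemporalPattern.grankLow_le_gdimReachable {N n : ℕ} {m : Fin N → ℕ}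
    (P : TemporalPattern N n m) : P.grankLow ≤ P.gdimReachable := by
  refine csSup_le ⟨_, ⟨fun _ => 0, fun _ => 0⟩, ⟨fun _ _ _ _ => rfl, fun _ _ _ _ => rfl⟩, rfl⟩ ?_
  rintro r ⟨S, hS, rfl⟩
  obtain ⟨t, ht, hle⟩ := S.exists_rank_le_finrank_reachableSubspace
  refine hle.trans (le_csSup ⟨n, ?_⟩ ⟨S, t, hS, ht, rfl⟩)
  rintro r ⟨S, t, -, -, rfl⟩
  simpa using Submodule.finrank_le (S.reachableSubspace t)

/-! ### Linear independence tools -/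

section LinearIndependence

/-- Given a linearly independent family indexed by pairs `(r, c)`, with infinitely many `c`, and a
finite-dimensional subspace `W`, the span of some slice `c` is disjoint from `W`. -/
theorem LinearIndependent.exists_disjoint_span_slice {K M κ ι : Type*} [Field K] [AddCommGroup M]
    [Module K M] [Infinite ι] {b : (_ : κ) × ι → M} (hb : LinearIndependent K b)
    (W : Submodule K M) [FiniteDimensional K W] :
    ∃ c, Disjoint W (Submodule.span K (range fun r => b ⟨r, c⟩)) := by
  -- Otherwise each slice contributes a nonzero vector of `W`; the spans of the slices are
  -- independent, so `W` would contain an infinite independent family.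
  by_contra! hcon
  have h1 : ∀ c, ∃ g ∈ W ⊓ Submodule.span K (range fun r => b ⟨r, c⟩), g ≠ 0 := fun c =>
    Submodule.exists_mem_ne_zero_of_ne_bot fun h => hcon c (disjoint_iff.2 h)
  choose g hg hg0 using h1
  have himage : ∀ c, (range fun r => b ⟨r, c⟩) = b '' {p | p.2 = c} := by
    intro c
    ext x
    constructor
    · rintro ⟨r, rfl⟩
      exact ⟨⟨r, c⟩, rfl, rfl⟩
    · rintro ⟨⟨r, c'⟩, rfl, rfl⟩
      exact ⟨r, rfl⟩
  have hind : iSupIndep fun c => Submodule.span K (range fun r => b ⟨r, c⟩) := by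
    intro c
    have hle : ⨆ c', ⨆ (_ : c' ≠ c), Submodule.span K (range fun r => b ⟨r, c'⟩) ≤
        Submodule.span K (b '' {p | p.2 ≠ c}) := by
      refine iSup₂_le fun c' hc' => Submodule.span_mono ?_
      rw [himage]
      exact image_mono fun p (hp : p.2 = c') (h : p.2 = c) => hc' (hp.symm.trans h)
    refine Disjoint.mono_right hle ?_
    change Disjoint (Submodule.span K (range fun r => b ⟨r, c⟩)) _
    rw [himage]
    exact hb.disjoint_span_image (disjoint_left.2 fun p hp hp' => hp' hp)
  have hli : LinearIndependent K g := hind.linearIndependent _ (fun c => (hg c).2) hg0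
  have hli' : LinearIndependent K (fun c => (⟨g c, (hg c).1⟩ : W)) :=
    LinearIndependent.of_comp W.subtype hli
  have := hli'.finite
  exact not_finite ι

/-- Dedekind's independence of characters, applied to the homomorphisms from the additive monoid `ℕ`
to `ℝ`. -/
theorem linearIndependent_pow_sequences :
    LinearIndependent ℝ (fun c : ℝ => fun k : ℕ => c ^ k) := by
  have h := (linearIndependent_monoidHom (Multiplicative ℕ) ℝ).comp (powersHom ℝ)
    (powersHom ℝ).injective
  exact h

theorem PowerSeries.linearIndependent_X_pow :
    LinearIndependent ℝ (fun d : ℕ => (PowerSeries.X ^ d : PowerSeries ℝ)) := by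
  rw [linearIndependent_iff']
  intro s a h i hi
  have := congrArg (PowerSeries.coeff i) h
  simpa [PowerSeries.coeff_X_pow, hi] using this

end LinearIndependence

/-! ### Power series carried by a cycle -/

section GeometricSeries

open PowerSeries

/-- The power series `X ^ r / (1 - c X ^ l)`, for `r < l`. -/
def geometricSeries (l : ℕ) (c : ℝ) (r : ℕ) : PowerSeries ℝ :=
  PowerSeries.mk fun j => if j % l = r then c ^ (j / l) else 0

/-- With `geometricSeries_zero`, this is the recursion around a cycle of length `l` that receives
the signal `1` at position `0` and has weight `c` on its closing edge. -/
theorem geometricSeries_succ {l r : ℕ} (c : ℝ) (h : r + 1 < l) :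
    geometricSeries l c (r + 1) = X * geometricSeries l c r := by
  ext j
  cases j with
  | zero => simp [geometricSeries]
  | succ j =>
    have hl : 0 < l := by omega
    rw [PowerSeries.coeff_succ_X_mul]
    simp only [geometricSeries, coeff_mk]
    by_cases hj : j % l = l - 1
    · have h1 : (j + 1) % l = 0 := by
        rw [Nat.add_mod, hj]
        rcases Nat.lt_or_ge 1 l with h1 | h1
        · rw [Nat.mod_eq_of_lt h1, Nat.sub_add_cancel hl, Nat.mod_self]
        · omega
      rw [if_neg (by omega), if_neg (by omega)]
    · have hlt := Nat.mod_lt j hl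
      have h0 := Nat.div_add_mod j l
      have h1 : (j + 1) % l = j % l + 1 ∧ (j + 1) / l = j / l := by
        rw [and_comm, Nat.div_mod_unique hl]
        omega
      rw [h1.1, h1.2]
      simp

theorem geometricSeries_zero {l : ℕ} (c : ℝ) (h : 0 < l) :
    geometricSeries l c 0 = 1 + c • (X * geometricSeries l c (l - 1)) := by
  ext j
  cases j with
  | zero => simp [geometricSeries]
  | succ j =>
    rw [map_add, LinearMap.map_smul, PowerSeries.coeff_succ_X_mul, PowerSeries.coeff_one]
    simp only [geometricSeries, coeff_mk]
    have hlt := Nat.mod_lt j h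
    have h0 := Nat.div_add_mod j l
    by_cases hj : j % l = l - 1
    · have h1 : (j + 1) / l = j / l + 1 ∧ (j + 1) % l = 0 := by
        rw [Nat.div_mod_unique h]
        constructor
        · rw [mul_add]; omega
        · omega
      rw [h1.1, h1.2, hj]
      simp [pow_succ']
    · have h1 : (j + 1) / l = j / l ∧ (j + 1) % l = j % l + 1 := by
        rw [Nat.div_mod_unique h]
        omega
      rw [h1.2]
      simp [hj]

/-- Sorting coefficients by residue mod `l` separates the `r`; within one residue class only the
sequences `c ^ k` remain. -/
theorem linearIndependent_geometricSeries (l : ℕ) :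
    LinearIndependent ℝ fun p : (_ : Fin l) × ℝ => geometricSeries l p.2 p.1 := by
  let φ : PowerSeries ℝ →ₗ[ℝ] (Fin l → ℕ → ℝ) :=
    LinearMap.pi fun r => LinearMap.pi fun k => PowerSeries.coeff (l * k + r)
  refine LinearIndependent.of_comp φ ?_
  have h := Pi.linearIndependent_single (R := ℝ) (fun (_ : Fin l) (c : ℝ) (k : ℕ) => c ^ k)
    fun _ => linearIndependent_pow_sequences
  suffices e : (φ ∘ fun p : (_ : Fin l) × ℝ => geometricSeries l p.2 p.1) =
      fun p => Pi.single p.1 fun k => p.2 ^ k by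
    rw [e]
    exact h
  funext ⟨r, c⟩ r' k
  have hl : 0 < l := r'.pos
  have h1 : (l * k + (r' : ℕ)) / l = k ∧ (l * k + (r' : ℕ)) % l = r' := by
    rw [Nat.div_mod_unique hl]
    exact ⟨by ring, r'.2⟩
  have h2 : φ (geometricSeries l c r) r' k = if r' = r then c ^ k else 0 := by
    simp only [φ, LinearMap.pi_apply, geometricSeries, coeff_mk, h1.1, h1.2, Fin.ext_iff]
  rw [Function.comp_apply, h2, Pi.single_apply]
  split_ifs <;> rfl

/-- Multiplication by a nonzero component of `h` is injective, because power series over `ℝ` form a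
domain. -/
theorem linearIndependent_geometricSeries_smul (l : ℕ) {κ : Type*} {h : κ → PowerSeries ℝ}
    (hh : h ≠ 0) :
    LinearIndependent ℝ fun p : (_ : Fin l) × ℝ => geometricSeries l p.2 p.1 • h := by
  obtain ⟨k, hk⟩ := Function.ne_iff.1 hh
  refine LinearIndependent.of_comp (LinearMap.proj (R := ℝ) (φ := fun _ => PowerSeries ℝ) k) ?_
  refine (linearIndependent_geometricSeries l).map' (LinearMap.mulRight ℝ (h k)) ?_
  rw [LinearMap.ker_eq_bot']
  intro x hx
  exact (mul_eq_zero.1 hx).resolve_right hk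

end GeometricSeries

/-! ### Weights and series built up vertex by vertex -/

section SeriesRealization

open PowerSeries

variable {n m : ℕ}

/-- A choice of weights on the edges of `G` entering the set `S` of state vertices, together with
the resulting series `∑ t, (A ^ t * B) v X ^ (t + 1)` of every vertex `v` of `S`; the inputs carry
the standard basis vectors. The series of the vertices in `S ∩ T` are linearly independent. -/
structure SeriesRealization (G : Digraph (Fin n ⊕ Fin m)) (T S : Set (Fin n)) where
  weight : Fin n → Fin n ⊕ Fin m → ℝ
  series : Fin n ⊕ Fin m → Fin m → PowerSeries ℝ
  adj : ∀ v ∈ S, ∀ u, weight v u ≠ 0 → G.Adj u (Sum.inl v)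
  -- No weighted edge enters `S` from a state vertex outside it, so later extensions leave the
  -- series on `S` unchanged.
  support : ∀ v ∈ S, ∀ u, weight v (Sum.inl u) ≠ 0 → u ∈ S
  input : ∀ k, series (Sum.inr k) = Pi.single k 1
  state : ∀ v ∈ S, series (Sum.inl v) = (X : PowerSeries ℝ) • ∑ u, weight v u • series u
  -- All that is asked of vertices outside `T`: a nonzero signal to pass on.
  ne_zero : ∀ v ∈ S, series (Sum.inl v) ≠ 0
  indep : LinearIndepOn ℝ (fun v => series (Sum.inl v)) (S ∩ T)

namespace SeriesRealization

variable {G : Digraph (Fin n ⊕ Fin m)} {T S : Set (Fin n)}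

theorem series_ne_zero (R : SeriesRealization G T S) {p : Fin n ⊕ Fin m}
    (hp : ∀ v, p = Sum.inl v → v ∈ S) : R.series p ≠ 0 := by
  rcases p with v | k
  · exact R.ne_zero v (hp v rfl)
  · rw [R.input]
    exact fun h => one_ne_zero (α := PowerSeries ℝ) (by simpa using congrFun h k)

open Classical in
/-- The series of all vertices after those of new state vertices have been set to `f`. -/
def extendSeries (R : SeriesRealization G T S) (f : Fin n → Fin m → PowerSeries ℝ) :
    Fin n ⊕ Fin m → Fin m → PowerSeries ℝ :=
  Sum.elim (fun v => if v ∈ S then R.series (Sum.inl v) else f v) fun k => Pi.single k 1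

theorem extendSeries_of_mem (R : SeriesRealization G T S) (f : Fin n → Fin m → PowerSeries ℝ)
    {p : Fin n ⊕ Fin m} (hp : ∀ v, p = Sum.inl v → v ∈ S) :
    R.extendSeries f p = R.series p := by
  rcases p with v | k
  · simp [extendSeries, hp v rfl]
  · simp [extendSeries, R.input]

theorem extendSeries_of_notMem (R : SeriesRealization G T S) (f : Fin n → Fin m → PowerSeries ℝ)
    {v : Fin n} (hv : v ∉ S) : R.extendSeries f (Sum.inl v) = f v := by
  simp [extendSeries, hv]

open Classical in
/-- Extension of a realization to a set `Q` of further vertices. -/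
def extend (R : SeriesRealization G T S) (Q : Set (Fin n)) (hQ : Disjoint S Q)
    (w : Fin n → Fin n ⊕ Fin m → ℝ) (f : Fin n → Fin m → PowerSeries ℝ)
    (hadj : ∀ v ∈ Q, ∀ u, w v u ≠ 0 → G.Adj u (Sum.inl v))
    (hsupp : ∀ v ∈ Q, ∀ u, w v (Sum.inl u) ≠ 0 → u ∈ S ∪ Q)
    (hstate : ∀ v ∈ Q, f v = (X : PowerSeries ℝ) • ∑ u, w v u • R.extendSeries f u)
    (hne : ∀ v ∈ Q, f v ≠ 0)
    (hind : LinearIndepOn ℝ f (Q ∩ T))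
    (hdisj : Disjoint (Submodule.span ℝ ((fun v => R.series (Sum.inl v)) '' (S ∩ T)))
      (Submodule.span ℝ (f '' (Q ∩ T)))) :
    SeriesRealization G T (S ∪ Q) where
  weight v := if v ∈ S then R.weight v else w v
  series := R.extendSeries f
  adj v hv u hu := by
    by_cases h : v ∈ S
    · exact R.adj v h u (by simpa [h] using hu)
    · exact hadj v (hv.resolve_left h) u (by simpa [h] using hu)
  support v hv u hu := by
    by_cases h : v ∈ S
    · exact Or.inl (R.support v h u (by simpa [h] using hu))
    · exact hsupp v (hv.resolve_left h) u (by simpa [h] using hu)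
  input k := rfl
  state v hv := by
    by_cases h : v ∈ S
    · rw [R.extendSeries_of_mem f (by simpa using h), R.state v h]
      simp only [if_pos h]
      congr 1
      refine Finset.sum_congr rfl fun u _ => ?_
      by_cases hu : R.weight v u = 0
      · simp [hu]
      · rw [R.extendSeries_of_mem f]
        rintro u rfl
        exact R.support v h u hu
    · rw [R.extendSeries_of_notMem f h]
      simp only [if_neg h]
      exact hstate v (hv.resolve_left h)
  ne_zero v hv := by
    by_cases h : v ∈ S
    · rw [R.extendSeries_of_mem f (by simpa using h)]
      exact R.ne_zero v h
    · rw [R.extendSeries_of_notMem f h]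
      exact hne v (hv.resolve_left h)
  indep := by
    have h1 : EqOn (fun v => R.extendSeries f (Sum.inl v)) (fun v => R.series (Sum.inl v))
        (S ∩ T) := fun v hv => R.extendSeries_of_mem f (by simpa using hv.1)
    have h2 : EqOn (fun v => R.extendSeries f (Sum.inl v)) f (Q ∩ T) := fun v hv =>
      R.extendSeries_of_notMem f fun h => disjoint_left.1 hQ h hv.1
    rw [union_inter_distrib_right]
    refine LinearIndepOn.union (R.indep.congr h1.symm) (hind.congr h2.symm) ?_
    rwa [image_congr h1, image_congr h2]

/-- A vertex outside `T` with an in-neighbour in `S` or among the inputs can be added. -/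
theorem nonempty_insert (R : SeriesRealization G T S) {p : Fin n ⊕ Fin m}
    (hp : ∀ v, p = Sum.inl v → v ∈ S) {v : Fin n} (hv : v ∉ S) (hvT : v ∉ T)
    (hpv : G.Adj p (Sum.inl v)) : Nonempty (SeriesRealization G T (S ∪ {v})) := by
  have hemp : ({v} : Set (Fin n)) ∩ T = ∅ := by simpa using hvT
  refine ⟨R.extend {v} (by simpa using hv) (fun _ => Pi.single p 1)
    (fun _ => (X : PowerSeries ℝ) • R.series p) ?_ ?_ ?_ ?_ ?_ ?_⟩
  · rintro _ rfl u hu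
    rcases eq_or_ne u p with rfl | h
    · exact hpv
    · simp [h] at hu
  · rintro _ rfl u hu
    rcases eq_or_ne (Sum.inl u) p with h | h
    · exact Or.inl (hp u h.symm)
    · simp [h] at hu
  · rintro _ rfl
    simp [Pi.single_apply, ite_smul, R.extendSeries_of_mem _ hp]
  · rintro _ rfl
    exact smul_ne_zero X_ne_zero (R.series_ne_zero hp)
  · rw [hemp]
    exact linearIndepOn_empty ℝ _
  · simp [hemp]

/-- A cycle that is disjoint from `S` and has a vertex with an in-neighbour in `S` or among the
inputs can be added. -/
theorem nonempty_union_cycle (R : SeriesRealization G T S) {p : Fin n ⊕ Fin m}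
    (hp : ∀ v, p = Sum.inl v → v ∈ S) {v₀ : Fin n} {q : List (Fin n)}
    (hnodup : (v₀ :: q).Nodup) (hdisj : Disjoint S {v | v ∈ v₀ :: q})
    (hchain : (v₀ :: (q ++ [v₀])).IsChain fun a b => G.Adj (Sum.inl a) (Sum.inl b))
    (hpv : G.Adj p (Sum.inl v₀)) :
    Nonempty (SeriesRealization G T (S ∪ {v | v ∈ v₀ :: q})) := by
  set L := v₀ :: q with hL
  set l := L.length with hl
  have hl0 : 0 < l := by simp [hl, hL]
  have hstep : ∀ r (hr : r + 1 < l), G.Adj (Sum.inl L[r]) (Sum.inl L[r + 1]) := by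
    intro r hr
    have := List.isChain_iff_getElem.1 hchain r (by simp [hl, hL] at hr ⊢; omega)
    have e : v₀ :: (q ++ [v₀]) = L ++ [v₀] := rfl
    simp only [e] at this
    rwa [List.getElem_append_left (by omega), List.getElem_append_left (by omega)] at this
  have hclose : G.Adj (Sum.inl L[l - 1]) (Sum.inl v₀) := by
    have := List.isChain_iff_getElem.1 hchain (l - 1) (by simp [hl, hL])
    have e : v₀ :: (q ++ [v₀]) = L ++ [v₀] := rfl
    simp only [e] at this
    rw [List.getElem_append_left (by omega), List.getElem_append_right (by omega)] at this
    simpa using this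
  have hmem : ∀ r (hr : r < l), L[r] ∉ S := fun r hr h =>
    disjoint_left.1 hdisj h (List.getElem_mem hr)
  set h : Fin m → PowerSeries ℝ := (X : PowerSeries ℝ) • R.series p with hh
  have hh0 : h ≠ 0 := smul_ne_zero X_ne_zero (R.series_ne_zero hp)
  have hli := linearIndependent_geometricSeries_smul l hh0
  set W := Submodule.span ℝ ((fun v => R.series (Sum.inl v)) '' (S ∩ T)) with hW
  have : FiniteDimensional ℝ W := FiniteDimensional.span_of_finite ℝ (Set.toFinite _)
  obtain ⟨c, hc⟩ := hli.exists_disjoint_span_slice W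
  set f : Fin n → Fin m → PowerSeries ℝ := fun v => geometricSeries l c (L.idxOf v) • h with hf
  have hidx : ∀ r (hr : r < l), L.idxOf L[r] = r := fun r hr => hnodup.idxOf_getElem r hr
  -- The entry vertex listens to `p` and, with weight `c`, to the last vertex (itself if `l = 1`);
  -- every other cycle vertex listens to its predecessor. The default of `getD` is never used on the
  -- cycle.
  set w : Fin n → Fin n ⊕ Fin m → ℝ := fun v =>
    if L.idxOf v = 0 then Pi.single p 1 + Pi.single (Sum.inl L[l - 1]) c
    else Pi.single (Sum.inl (L.getD (L.idxOf v - 1) v)) 1 with hw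
  have hw0 : w L[0] = Pi.single p 1 + Pi.single (Sum.inl L[l - 1]) c := by
    simp only [hw, hidx 0 hl0, if_true]
  have hw1 : ∀ r (hr : r + 1 < l), w L[r + 1] = Pi.single (Sum.inl L[r]) 1 := by
    intro r hr
    simp only [hw, hidx (r + 1) hr, Nat.add_one_ne_zero, if_false, Nat.add_sub_cancel]
    rw [List.getD_eq_getElem _ _ (by omega)]
  have hinj : InjOn (fun v => (⟨⟨L.idxOf v % l, Nat.mod_lt _ hl0⟩, c⟩ : (_ : Fin l) × ℝ))
      {v | v ∈ L} := by
    intro a ha b hb hab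
    have h1 : L.idxOf a < l := List.idxOf_lt_length_of_mem ha
    have h2 : L.idxOf b < l := List.idxOf_lt_length_of_mem hb
    simp only [Sigma.mk.injEq, heq_eq_eq, and_true, Fin.mk.injEq, Nat.mod_eq_of_lt h1,
      Nat.mod_eq_of_lt h2] at hab
    exact (List.idxOf_inj ha).1 hab
  refine ⟨R.extend {v | v ∈ L} hdisj w f ?_ ?_ ?_ ?_ ?_ ?_⟩
  · intro v hv u hu
    obtain ⟨r, hr, rfl⟩ := List.getElem_of_mem hv
    cases r with
    | zero =>
      rw [hw0] at hu
      by_cases h1 : u = p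
      · subst h1; exact hpv
      by_cases h2 : u = Sum.inl L[l - 1]
      · subst h2; exact hclose
      · simp [h1, h2] at hu
    | succ r =>
      rw [hw1 r hr] at hu
      by_cases h2 : u = Sum.inl L[r]
      · subst h2; exact hstep r hr
      · simp [h2] at hu
  · intro v hv u hu
    obtain ⟨r, hr, rfl⟩ := List.getElem_of_mem hv
    cases r with
    | zero =>
      rw [hw0] at hu
      by_cases h1 : Sum.inl u = p
      · exact Or.inl (hp u h1.symm)
      by_cases h2 : u = L[l - 1]
      · subst h2; exact Or.inr (List.getElem_mem _)
      · simp [h1, h2] at hu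
    | succ r =>
      rw [hw1 r hr] at hu
      by_cases h2 : u = L[r]
      · subst h2; exact Or.inr (List.getElem_mem _)
      · simp [h2] at hu
  · intro v hv
    obtain ⟨r, hr, rfl⟩ := List.getElem_of_mem hv
    cases r with
    | zero =>
      rw [hw0]
      simp only [Pi.add_apply, add_smul, Finset.sum_add_distrib, Pi.single_apply, ite_smul,
        zero_smul, one_smul, Finset.sum_ite_eq', Finset.mem_univ, if_true]
      rw [R.extendSeries_of_mem f hp, R.extendSeries_of_notMem f (hmem _ _)]
      simp only [hf, hidx _ hl0, hidx (l - 1) (by omega)]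
      rw [geometricSeries_zero c hl0, smul_add, ← hh, add_smul, one_smul, smul_comm X c, smul_assoc,
        mul_smul]
    | succ r =>
      rw [hw1 r hr]
      simp only [Pi.single_apply, ite_smul,
        zero_smul, one_smul, Finset.sum_ite_eq', Finset.mem_univ, if_true]
      rw [R.extendSeries_of_notMem f (hmem _ _)]
      simp only [hf, hidx _ hr, hidx r (by omega)]
      rw [geometricSeries_succ c hr, mul_smul]
  · intro v hv
    have h1 : L.idxOf v < l := List.idxOf_lt_length_of_mem hv
    exact hli.ne_zero ⟨⟨L.idxOf v, h1⟩, c⟩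
  · refine LinearIndepOn.mono (?_ : LinearIndepOn ℝ f {v | v ∈ L}) inter_subset_left
    have h1 := hli.comp (fun v : {v | v ∈ L} =>
      (⟨⟨L.idxOf v.1 % l, Nat.mod_lt _ hl0⟩, c⟩ : (_ : Fin l) × ℝ)) hinj.injective
    change LinearIndependent ℝ fun v : {v | v ∈ L} => f v
    convert h1 using 1
    funext ⟨v, hv⟩
    have h1 : L.idxOf v < l := List.idxOf_lt_length_of_mem hv
    simp [hf, Nat.mod_eq_of_lt h1]
  · refine hc.mono_right (Submodule.span_mono ?_)
    rintro _ ⟨v, hv, rfl⟩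
    exact ⟨⟨L.idxOf v, List.idxOf_lt_length_of_mem hv.1⟩, rfl⟩

/-- The coefficients of the series are the entries of the matrices `A ^ t * B`. -/
theorem coeff_succ_series (R : SeriesRealization G T S) {A : Matrix (Fin n) (Fin n) ℝ}
    {B : Matrix (Fin n) (Fin m) ℝ} (hA : ∀ v ∈ S, ∀ u, A v u = R.weight v (Sum.inl u))
    (hB : ∀ v ∈ S, ∀ k, B v k = R.weight v (Sum.inr k)) (t : ℕ) :
    ∀ v ∈ S, ∀ k, coeff (t + 1) (R.series (Sum.inl v) k) = (A ^ t * B) v k := by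
  have hcoeff : ∀ v ∈ S, ∀ k t, coeff (t + 1) (R.series (Sum.inl v) k) =
      ∑ u, R.weight v (Sum.inl u) * coeff t (R.series (Sum.inl u) k) +
      ∑ j, R.weight v (Sum.inr j) * coeff t (R.series (Sum.inr j) k) := by
    intro v hv k t
    rw [R.state v hv, Pi.smul_apply, smul_eq_mul, coeff_succ_X_mul, Finset.sum_apply, map_sum,
      Fintype.sum_sum_type]
    simp
  have hzero : ∀ v ∈ S, ∀ k, coeff 0 (R.series (Sum.inl v) k) = 0 := by
    intro v hv k
    rw [R.state v hv, Pi.smul_apply, smul_eq_mul]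
    simp
  induction t with
  | zero =>
    intro v hv k
    rw [hcoeff v hv, Finset.sum_eq_zero, zero_add, pow_zero, Matrix.one_mul, hB v hv]
    · rw [Finset.sum_eq_single k]
      · simp [R.input]
      · intro j _ hj
        simp [R.input, hj.symm]
      · simp
    · intro u _
      by_cases hu : R.weight v (Sum.inl u) = 0
      · simp [hu]
      · rw [hzero u (R.support v hv u hu), mul_zero]
  | succ t ih =>
    intro v hv k
    rw [hcoeff v hv, pow_succ', Matrix.mul_assoc, Matrix.mul_apply]
    -- Input series are constant, so inputs contribute directly only to the coefficient of `X`.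
    have h2 : ∑ j, R.weight v (Sum.inr j) * coeff (t + 1) (R.series (Sum.inr j) k) = 0 := by
      refine Finset.sum_eq_zero fun j _ => ?_
      rw [R.input, Pi.single_apply]
      split_ifs <;> simp [coeff_one]
    rw [h2, add_zero]
    refine Finset.sum_congr rfl fun u _ => ?_
    rw [hA v hv]
    by_cases hu : R.weight v (Sum.inl u) = 0
    · simp [hu]
    · rw [ih u (R.support v hv u hu)]

end SeriesRealization

end SeriesRealization

/-! ### Cactus configurations give independent rows -/

section CactusConfigurations

open PowerSeries

variable {n m : ℕ} {G : Digraph (Fin n ⊕ Fin m)}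

theorem List.IsChain.exists_rel_of_mem_tail {α : Type*} {r : α → α → Prop} {a : α} {l : List α}
    (h : (a :: l).IsChain r) {x : α} (hx : x ∈ l) : ∃ y, r y x := by
  obtain ⟨i, hi, rfl⟩ := List.getElem_of_mem hx
  exact ⟨_, List.isChain_iff_getElem.1 h i (by simpa using hi)⟩

/-- A cycle consists of state vertices, and it can be started at any of its vertices. -/
theorem IsCycle.exists_rotation (hG : ∀ u k, ¬ G.Adj u (Sum.inr k)) {p : List (Fin n ⊕ Fin m)}
    (hp : IsCycle G p) {v₀ : Fin n} (hv₀ : Sum.inl v₀ ∈ p) :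
    ∃ q : List (Fin n), (v₀ :: q).Nodup ∧ (∀ v, Sum.inl v ∈ p ↔ v ∈ v₀ :: q) ∧
      (v₀ :: (q ++ [v₀])).IsChain fun a b => G.Adj (Sum.inl a) (Sum.inl b) := by
  obtain ⟨⟨a, s, rfl, hchain⟩, hnodup⟩ := hp
  -- Every vertex of a cycle has a predecessor, and inputs have none.
  have hstate : (a :: s) ∈ range (List.map (Sum.inl : Fin n → Fin n ⊕ Fin m)) := by
    rw [Set.range_list_map]
    intro x hx
    have hx' : x ∈ s ++ [a] := by simpa [or_comm] using hx
    obtain ⟨y, hy⟩ := hchain.exists_rel_of_mem_tail hx'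
    rcases x with x | k
    · exact ⟨x, rfl⟩
    · exact absurd hy (hG y k)
  obtain ⟨L, hL⟩ := hstate
  have hcyc : Cycle.Chain G.Adj ((a :: s : List _) : Cycle (Fin n ⊕ Fin m)) :=
    (Cycle.chain_coe_cons _ _ _).2 hchain
  rw [← hL] at hcyc hnodup hv₀ ⊢
  rw [← Cycle.map_coe, Cycle.chain_map] at hcyc
  have hv : v₀ ∈ L := by simpa using hv₀
  obtain ⟨l₁, l₂, rfl⟩ := List.append_of_mem hv
  have hrot : (l₁ ++ v₀ :: l₂) ~r (v₀ :: (l₂ ++ l₁)) := List.isRotated_append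
  refine ⟨l₂ ++ l₁, hrot.nodup_iff.1 (List.Nodup.of_map _ hnodup), fun v => ?_, ?_⟩
  · rw [← hrot.mem_iff]
    simp
  · rw [Cycle.coe_eq_coe.2 hrot, Cycle.chain_coe_cons] at hcyc
    exact hcyc

/-- The series realization on the state vertices of a collection of disjoint stems. -/
theorem SeriesRealization.nonempty_stems (hG : ∀ u k, ¬ G.Adj u (Sum.inr k)) (T : Set (Fin n))
    {F : Set (List (Fin n ⊕ Fin m))} (hF : F.Pairwise List.Disjoint) :
    Nonempty (SeriesRealization G T {v | ∃ p ∈ F, IsStem G p ∧ Sum.inl v ∈ p}) := by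
  set S : Set (Fin n) := {v | ∃ p ∈ F, IsStem G p ∧ Sum.inl v ∈ p} with hS
  have huniq : ∀ p ∈ F, ∀ p' ∈ F, ∀ x ∈ p, x ∈ p' → p = p' := by
    intro p hp p' hp' x hx hx'
    by_contra hne
    exact hF hp hp' hne hx hx'
  -- `D x k d`: the vertex `x` has position `d` on the stem starting at input `k`. Disjointness
  -- makes `x` and `(k, d)` determine each other, so distinct vertices get distinct monomials `X ^
  -- d` in component `k`.
  let D : Fin n ⊕ Fin m → Fin m → ℕ → Prop := fun x k d =>
    ∃ p ∈ F, IsStem G p ∧ p[0]? = some (Sum.inr k) ∧ p[d]? = some x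
  have hDfun : ∀ {x k d k' d'}, D x k d → D x k' d' → k = k' ∧ d = d' := by
    rintro x k d k' d' ⟨p, hp, hs, h0, hd⟩ ⟨p', hp', -, h0', hd'⟩
    obtain rfl := huniq p hp p' hp' x (List.mem_of_getElem? hd) (List.mem_of_getElem? hd')
    obtain ⟨hdl, -⟩ := List.getElem?_eq_some_iff.1 hd
    refine ⟨?_, (List.getElem?_inj hdl hs.2.2).1 (hd.trans hd'.symm)⟩
    rw [h0] at h0'
    simpa using h0'
  have hDinj : ∀ {x x' k d}, D x k d → D x' k d → x = x' := by
    rintro x x' k d ⟨p, hp, hs, h0, hd⟩ ⟨p', hp', -, h0', hd'⟩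
    obtain rfl := huniq p hp p' hp' _ (List.mem_of_getElem? h0) (List.mem_of_getElem? h0')
    rw [hd] at hd'
    simpa using hd'
  have hDpred : ∀ {v k d}, D (Sum.inl v) k d →
      ∃ e u, d = e + 1 ∧ D u k e ∧ G.Adj u (Sum.inl v) := by
    rintro v k d ⟨p, hp, hs, h0, hd⟩
    cases d with
    | zero => rw [h0] at hd; simp at hd
    | succ e =>
      obtain ⟨hlt, he⟩ := List.getElem?_eq_some_iff.1 hd
      refine ⟨e, p[e], rfl, ⟨p, hp, hs, h0, List.getElem?_eq_getElem _⟩, ?_⟩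
      rw [← he]
      exact List.isChain_iff_getElem.1 hs.2.1 e hlt
  have hDinr : ∀ {j k d}, D (Sum.inr j) k d → j = k ∧ d = 0 := by
    rintro j k d ⟨p, hp, hs, h0, hd⟩
    cases d with
    | zero => rw [h0] at hd; simpa [eq_comm] using hd
    | succ e =>
      obtain ⟨hlt, he⟩ := List.getElem?_eq_some_iff.1 hd
      have := List.isChain_iff_getElem.1 hs.2.1 e hlt
      rw [he] at this
      exact absurd this (hG _ _)
  have hDS : ∀ {v k d}, D (Sum.inl v) k d → v ∈ S := by
    rintro v k d ⟨p, hp, hs, -, hd⟩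
    exact ⟨p, hp, hs, List.mem_of_getElem? hd⟩
  have hSD : ∀ v ∈ S, ∃ k d, D (Sum.inl v) k d := by
    rintro v ⟨p, hp, hs, hv⟩
    obtain ⟨d, hd⟩ := List.getElem?_of_mem hv
    obtain ⟨k, q, rfl⟩ := hs.1
    exact ⟨k, d, _, hp, hs, rfl, hd⟩
  have hchoice : ∀ v, ∃ (f : Fin m → PowerSeries ℝ) (u : Fin n ⊕ Fin m), v ∈ S →
      ∃ k d, D (Sum.inl v) k (d + 1) ∧ D u k d ∧ G.Adj u (Sum.inl v) ∧
        f = Pi.single k (X ^ (d + 1)) := by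
    intro v
    by_cases hv : v ∈ S
    · obtain ⟨k, d, hkd⟩ := hSD v hv
      obtain ⟨e, u, rfl, hu, hadj⟩ := hDpred hkd
      exact ⟨_, u, fun _ => ⟨k, e, hkd, hu, hadj, rfl⟩⟩
    · exact ⟨0, Sum.inl v, fun h => absurd h hv⟩
  choose f u hfu using hchoice
  have hsingle : ∀ v, ∑ x, (Pi.single (u v) 1 : Fin n ⊕ Fin m → ℝ) x •
      Sum.elim f (fun k => Pi.single k 1) x = Sum.elim f (fun k => Pi.single k 1) (u v) := by
    intro v
    simp [Pi.single_apply, ite_smul]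
  refine ⟨⟨fun v => Pi.single (u v) 1, Sum.elim f fun k => Pi.single k 1, ?_, ?_, fun _ => rfl,
    ?_, ?_, ?_⟩⟩
  · intro v hv x hx
    obtain ⟨k, d, -, -, hadj, -⟩ := hfu v hv
    rcases eq_or_ne x (u v) with rfl | h
    · exact hadj
    · simp [h] at hx
  · intro v hv x hx
    obtain ⟨k, d, -, hu, -, -⟩ := hfu v hv
    rcases eq_or_ne (Sum.inl x) (u v) with h | h
    · rw [← h] at hu
      exact hDS hu
    · simp [h] at hx
  · intro v hv
    obtain ⟨k, d, -, hu, -, hfv⟩ := hfu v hv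
    rw [hsingle, Sum.elim_inl, hfv]
    rcases hx : u v with w | j
    · rw [hx] at hu
      obtain ⟨k', d', hw, -, -, hfw⟩ := hfu w (hDS hu)
      obtain ⟨rfl, rfl⟩ := hDfun hw hu
      rw [Sum.elim_inl, hfw, ← Pi.single_smul, smul_eq_mul, pow_succ' _ (d' + 1)]
    · rw [hx] at hu
      obtain ⟨rfl, rfl⟩ := hDinr hu
      rw [Sum.elim_inr, ← Pi.single_smul]
      simp
  · intro v hv
    obtain ⟨k, d, -, -, -, hfv⟩ := hfu v hv
    rw [Sum.elim_inl, hfv]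
    simp [Pi.single_eq_zero_iff, X_ne_zero]
  · refine LinearIndepOn.mono (?_ : LinearIndepOn ℝ f S) inter_subset_left
    have hk : ∀ v : S, ∃ kd : (_ : Fin m) × ℕ, D (Sum.inl v.1) kd.1 kd.2 ∧
        f v = Pi.single kd.1 (X ^ kd.2) := by
      rintro ⟨v, hv⟩
      obtain ⟨k, d, hD, -, -, hfv⟩ := hfu v hv
      exact ⟨⟨k, d + 1⟩, hD, hfv⟩
    choose κ hκD hκf using hk
    have hκ : Function.Injective κ := by
      intro v w hvw
      have h1 := hκD v
      rw [hvw] at h1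
      exact Subtype.ext (Sum.inl_injective (hDinj h1 (hκD w)))
    have h := (Pi.linearIndependent_single (R := ℝ)
      (fun (_ : Fin m) (d : ℕ) => (X ^ d : PowerSeries ℝ))
      fun _ => PowerSeries.linearIndependent_X_pow).comp κ hκ
    have e : (fun v : S => f v) = (fun p : (_ : Fin m) × ℕ =>
        (Pi.single p.1 (X ^ p.2) : Fin m → PowerSeries ℝ)) ∘ κ := funext hκf
    change LinearIndependent ℝ fun v : S => f v
    rw [e]
    exact h

/-- If `V` is covered by a cactus configuration, then the rows of `[B, AB, A²B, …]` that belong to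
`V` are linearly independent for some weights on the edges. -/
theorem CoveredByCactus.exists_linearIndepOn (hG : ∀ u k, ¬ G.Adj u (Sum.inr k))
    {V : Finset (Fin n)} (hV : CoveredByCactus G V) :
    ∃ (A : Matrix (Fin n) (Fin n) ℝ) (B : Matrix (Fin n) (Fin m) ℝ),
      (∀ v u, A v u ≠ 0 → G.Adj (Sum.inl u) (Sum.inl v)) ∧
      (∀ v k, B v k ≠ 0 → G.Adj (Sum.inr k) (Sum.inl v)) ∧
      LinearIndepOn ℝ (fun v (c : ℕ × Fin m) => (A ^ c.1 * B) v c.2) (V : Set (Fin n)) := by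
  classical
  obtain ⟨hreach, F, hF, hdisj, hcov⟩ := hV
  set T : Set (Fin n) := {v | ∃ p ∈ F, Sum.inl v ∈ p} with hT
  set S₀ : Set (Fin n) := {v | ∃ p ∈ F, IsStem G p ∧ Sum.inl v ∈ p} with hS₀
  have huniq : ∀ p ∈ F, ∀ p' ∈ F, ∀ x ∈ p, x ∈ p' → p = p' := by
    intro p hp p' hp' x hx hx'
    by_contra hne
    exact hdisj hp hp' hne hx hx'
  -- The middle condition keeps each cycle wholly inside or wholly outside `S`, so that a cycle can
  -- be added in one move.
  set E : Set (Set (Fin n)) := {S | S₀ ⊆ S ∧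
    (∀ p ∈ F, ∀ v w, Sum.inl v ∈ p → Sum.inl w ∈ p → v ∈ S → w ∈ S) ∧
    Nonempty (SeriesRealization G T S)} with hE
  have hEne : E.Nonempty := by
    refine ⟨S₀, subset_rfl, ?_, SeriesRealization.nonempty_stems hG T hdisj⟩
    rintro p hp v w hv hw ⟨p', hp', hs, hv'⟩
    obtain rfl := huniq p hp p' hp' _ hv hv'
    exact ⟨p, hp, hs, hw⟩
  obtain ⟨S, ⟨hS0, hScl, ⟨R⟩⟩, hmax⟩ := (Set.toFinite E).exists_maximal hEne
  -- By maximality `S` is closed under edges leaving it or the inputs: a new head would bring in its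
  -- whole cycle, or just itself when it lies off the cactus.
  have hstep : ∀ p v, (∀ w, p = Sum.inl w → w ∈ S) → G.Adj p (Sum.inl v) → v ∈ S := by
    intro p v hp hpv
    by_contra hv
    by_cases hvT : v ∈ T
    · obtain ⟨P, hP, hvP⟩ := hvT
      rcases hF P hP with hc | hs
      · obtain ⟨q, hnodup, hmem, hchain⟩ := hc.exists_rotation hG hvP
        have hd : Disjoint S {w | w ∈ v :: q} := by
          rw [disjoint_left]
          intro w hw hwq
          exact hv (hScl P hP w v ((hmem w).2 hwq) hvP hw)
        refine hv (hmax ⟨hS0.trans subset_union_left, ?_,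
          R.nonempty_union_cycle hp hnodup hd hchain hpv⟩ subset_union_left (Or.inr (by simp)))
        rintro p' hp' a b ha hb (haS | haq)
        · exact Or.inl (hScl p' hp' a b ha hb haS)
        · obtain rfl := huniq p' hp' P hP _ ha ((hmem a).2 haq)
          exact Or.inr ((hmem b).1 hb)
      · exact hv (hS0 ⟨P, hP, hs, hvP⟩)
    · refine hv (hmax ⟨hS0.trans subset_union_left, ?_, R.nonempty_insert hp hv hvT hpv⟩
        subset_union_left (Or.inr rfl))
      rintro p' hp' a b ha hb (haS | rfl)
      · exact Or.inl (hScl p' hp' a b ha hb haS)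
      · exact absurd ⟨p', hp', ha⟩ hvT
  have hVS : ∀ v ∈ V, v ∈ S := by
    intro v hv
    obtain ⟨k, hk⟩ := hreach v hv
    have hpath : ∀ x, Relation.ReflTransGen G.Adj (Sum.inr k) x → ∀ w, x = Sum.inl w → w ∈ S := by
      intro x hx
      induction hx with
      | refl => simp
      | tail _ hbc ih =>
        rintro w rfl
        exact hstep _ w ih hbc
    exact hpath _ hk v rfl
  refine ⟨Matrix.of fun v u => if v ∈ S then R.weight v (Sum.inl u) else 0,
    Matrix.of fun v k => if v ∈ S then R.weight v (Sum.inr k) else 0, ?_, ?_, ?_⟩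
  · intro v u hvu
    by_cases hv : v ∈ S
    · exact R.adj v hv _ (by simpa [hv] using hvu)
    · simp [hv] at hvu
  · intro v u hvu
    by_cases hv : v ∈ S
    · exact R.adj v hv _ (by simpa [hv] using hvu)
    · simp [hv] at hvu
  · set A : Matrix (Fin n) (Fin n) ℝ := Matrix.of fun v u =>
      if v ∈ S then R.weight v (Sum.inl u) else 0 with hA
    set B : Matrix (Fin n) (Fin m) ℝ := Matrix.of fun v k =>
      if v ∈ S then R.weight v (Sum.inr k) else 0 with hB
    have hcoeff := R.coeff_succ_series (A := A) (B := B) (fun v hv u => by simp [hA, hv])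
      (fun v hv u => by simp [hB, hv])
    have hind : LinearIndepOn ℝ (fun v => R.series (Sum.inl v)) (V : Set (Fin n)) :=
      R.indep.mono fun v hv => ⟨hVS v hv, hcov v hv⟩
    rw [linearIndepOn_finset_iff] at hind ⊢
    intro a ha
    refine hind a ?_
    funext k
    ext t
    rw [Finset.sum_apply, Pi.zero_apply, map_sum]
    cases t with
    | zero =>
      rw [map_zero]
      refine Finset.sum_eq_zero fun v hv => ?_
      rw [R.state v (hVS v hv)]
      simp
    | succ t =>
      have h1 := congrFun ha (t, k)
      rw [Finset.sum_apply, Pi.zero_apply] at h1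
      rw [map_zero, ← h1]
      refine Finset.sum_congr rfl fun v hv => ?_
      rw [Pi.smul_apply, LinearMap.map_smul, hcoeff t v (hVS v hv) k, Pi.smul_apply]

end CactusConfigurations

/-! ### Truncation, diagonal similarity and rank -/

section ControllabilityMatrix

variable {n m : ℕ}

/-- By the Cayley-Hamilton theorem a row vector that annihilates `A ^ t * B` for `t < n` does so
for all `t`. -/
theorem Matrix.vecMul_pow_mul_eq_zero {A : Matrix (Fin n) (Fin n) ℝ}
    {B : Matrix (Fin n) (Fin m) ℝ} {a : Fin n → ℝ}
    (h : ∀ t < n, Matrix.vecMul a (A ^ t * B) = 0) (t : ℕ) :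
    Matrix.vecMul a (A ^ t * B) = 0 := by
  -- For `n = 0` the characteristic polynomial is `1` and the strict degree bound on the remainder
  -- fails.
  rcases Nat.eq_zero_or_pos n with rfl | hn
  · funext k
    simp [Matrix.vecMul, dotProduct]
  have : Nonempty (Fin n) := ⟨⟨0, hn⟩⟩
  rw [Matrix.pow_eq_aeval_mod_charpoly, Polynomial.aeval_eq_sum_range' (n := n), Matrix.sum_mul,
    Matrix.vecMul_sum]
  · refine Finset.sum_eq_zero fun i hi => ?_
    rw [Matrix.smul_mul, Matrix.vecMul_smul, h i (Finset.mem_range.1 hi), smul_zero]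
  · have h1 := Polynomial.natDegree_modByMonic_lt (Polynomial.X ^ t : Polynomial ℝ)
      A.charpoly_monic (fun h1 => by
        have := A.charpoly_natDegree_eq_dim
        simp [h1] at this
        omega)
    simpa using h1

/-- A relation among the truncated rows, extended by zero off `V`, is a row vector to which
`Matrix.vecMul_pow_mul_eq_zero` applies. -/
theorem linearIndepOn_ctrbMatrix {A : Matrix (Fin n) (Fin n) ℝ} {B : Matrix (Fin n) (Fin m) ℝ}
    {V : Finset (Fin n)}
    (h : LinearIndepOn ℝ (fun v (c : ℕ × Fin m) => (A ^ c.1 * B) v c.2) (V : Set (Fin n))) :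
    LinearIndepOn ℝ (ctrbMatrix A B).row (V : Set (Fin n)) := by
  classical
  rw [linearIndepOn_finset_iff] at h ⊢
  intro a ha
  have hsum : ∀ t k, Matrix.vecMul (fun v => if v ∈ V then a v else 0) (A ^ t * B) k =
      ∑ v ∈ V, a v * (A ^ t * B) v k := by
    intro t k
    simp [Matrix.vecMul, dotProduct, ite_mul, Finset.sum_ite_mem]
  have hall := Matrix.vecMul_pow_mul_eq_zero (A := A) (B := B)
    (a := fun v => if v ∈ V then a v else 0) (fun t ht => by
      funext k
      have := congrFun ha (⟨t, ht⟩, k)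
      rw [hsum]
      simpa [ctrbMatrix] using this)
  refine h a ?_
  funext ⟨t, k⟩
  have := congrFun (hall t) k
  rw [hsum] at this
  simpa using this

/-- A diagonal change of coordinates scales the rows of the controllability matrix. -/
theorem ctrbMatrix_diagonal_conj (A : Matrix (Fin n) (Fin n) ℝ) (B : Matrix (Fin n) (Fin m) ℝ)
    {d : Fin n → ℝ} (hd : ∀ v, d v ≠ 0) :
    ctrbMatrix (Matrix.diagonal d * A * Matrix.diagonal d⁻¹) (Matrix.diagonal d * B) =
      Matrix.diagonal d * ctrbMatrix A B := by
  have hinv : Matrix.diagonal d⁻¹ * Matrix.diagonal d = 1 := by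
    rw [Matrix.diagonal_mul_diagonal, ← Matrix.diagonal_one]
    congr 1
    funext v
    simp [hd v]
  have hpow : ∀ t, (Matrix.diagonal d * A * Matrix.diagonal d⁻¹) ^ t * (Matrix.diagonal d * B) =
      Matrix.diagonal d * (A ^ t * B) := by
    intro t
    induction t with
    | zero => simp
    | succ t ih =>
      rw [pow_succ', Matrix.mul_assoc, ih, Matrix.mul_assoc, ← Matrix.mul_assoc _ _ (A ^ t * B),
        hinv, Matrix.one_mul, pow_succ', Matrix.mul_assoc, Matrix.mul_assoc]
  ext v ⟨t, k⟩
  simp [ctrbMatrix, hpow, Matrix.diagonal_mul]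

theorem LinearIndepOn.card_le_rank {ι κ : Type*} [Finite ι] [Fintype κ] {M : Matrix ι κ ℝ}
    {U : Finset ι} (h : LinearIndepOn ℝ M.row (U : Set ι)) : U.card ≤ M.rank := by
  rw [Matrix.rank_eq_finrank_span_row, ← Fintype.card_coe]
  have h1 : LinearIndependent ℝ fun v : U =>
      (⟨M.row v, Submodule.subset_span ⟨v, rfl⟩⟩ : Submodule.span ℝ (range M.row)) :=
    LinearIndependent.of_comp (Submodule.subtype _) h
  exact h1.fintype_card_le_finrank

end ControllabilityMatrix

/-! ### Combining the subsystems -/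

namespace TemporalPattern

variable {N n : ℕ} {m : Fin N → ℕ} (P : TemporalPattern N n m)

/-- There is a realization for which the rows of `[C_N, …, C_1]` that belong to the union of the
covered sets are linearly independent. -/
theorem exists_isRealization_linearIndepOn (V : Fin N → Finset (Fin n))
    (hV : ∀ i, CoveredByCactus (P.digraph i) (V i)) :
    ∃ S : TemporalSystem N n m, P.IsRealization S ∧
      LinearIndepOn ℝ S.lowMatrix.row (Finset.univ.biUnion V : Set (Fin n)) := by
  classical
  choose A B hA hB hAB using fun i => (hV i).exists_linearIndepOn (G := P.digraph i) (by
    rintro (u | u) k h <;> exact h)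
  set U : Finset (Fin n) := Finset.univ.biUnion V with hU
  have hidx : ∀ v : U, ∃ i, v.1 ∈ V i := fun v => by
    obtain ⟨i, -, hi⟩ := Finset.mem_biUnion.1 v.2
    exact ⟨i, hi⟩
  choose ι hι using hidx
  -- `ι` assigns each vertex to one subsystem covering it. Off `U` any nonzero scale would do.
  let d : ℝ → Fin N → Fin n → ℝ := fun ε i v =>
    if h : v ∈ U then (if ι ⟨v, h⟩ = i then 1 else ε) else 1
  let f : ℝ → U → ((i : Fin N) × (Fin n × Fin (m i))) → ℝ := fun ε v c =>
    d ε c.1 v * ctrbMatrix (A c.1) (B c.1) v c.2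
  -- At `ε = 0`, block `ι v` sees only rows assigned to it; these lie in `V (ι v)`, where the rows
  -- are independent.
  have hf0 : LinearIndependent ℝ (f 0) := by
    rw [Fintype.linearIndependent_iff]
    intro a ha v
    have hrow := linearIndepOn_ctrbMatrix (hAB (ι v))
    rw [linearIndepOn_finset_iff] at hrow
    have hsum := hrow (fun w => if h : w ∈ U then (if ι ⟨w, h⟩ = ι v then a ⟨w, h⟩ else 0) else 0)
      ?_ v.1 (hι v)
    · simpa using hsum
    · funext c
      have h1 := congrFun ha ⟨ι v, c⟩
      rw [Finset.sum_apply, Pi.zero_apply] at h1 ⊢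
      refine Eq.trans ?_ h1
      have hsub : V (ι v) ⊆ U := Finset.subset_biUnion_of_mem V (Finset.mem_univ _)
      rw [Finset.sum_subset hsub, ← Finset.sum_coe_sort U]
      · refine Finset.sum_congr rfl fun w _ => ?_
        simp [f, d, ite_mul]
      · intro w hw hwV
        have hne : ι ⟨w, hw⟩ ≠ ι v := fun h => hwV (h ▸ hι ⟨w, hw⟩)
        simp [hw, hne]
  have hcont : Continuous f := by
    refine continuous_pi fun v => continuous_pi fun c => ?_
    refine Continuous.mul ?_ continuous_const
    simp only [d]
    split_ifs <;> fun_prop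
  -- The neighbourhood is punctured because the diagonal similarity needs `ε ≠ 0`.
  have hev : ∀ᶠ ε in 𝓝[≠] (0 : ℝ), LinearIndependent ℝ (f ε) :=
    (hcont.tendsto 0).mono_left nhdsWithin_le_nhds |>.eventually
      (isOpen_setOfPred_linearIndependent.mem_nhds hf0)
  obtain ⟨ε, hε, hε0⟩ := (hev.and self_mem_nhdsWithin).exists
  have hd : ∀ i v, d ε i v ≠ 0 := by
    intro i v
    simp only [d]
    split_ifs
    · exact one_ne_zero
    · exact hε0
    · exact one_ne_zero
  refine ⟨⟨fun i => Matrix.diagonal (d ε i) * A i * Matrix.diagonal (d ε i)⁻¹,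
    fun i => Matrix.diagonal (d ε i) * B i⟩, ⟨?_, ?_⟩, ?_⟩
  · intro i j k hjk
    have : A i j k = 0 := by
      by_contra h
      exact hjk (hA i j k h)
    simp [Matrix.mul_diagonal, Matrix.diagonal_mul, this]
  · intro i j k hjk
    have : B i j k = 0 := by
      by_contra h
      exact hjk (hB i j k h)
    simp [Matrix.diagonal_mul, this]
  · refine (linearIndependent_equiv' (Equiv.refl U) ?_).1 hε
    funext v c
    simp [TemporalSystem.lowMatrix, ctrbMatrix_diagonal_conj _ _ (hd c.1), f,
      Matrix.diagonal_mul]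

theorem rank_le_grankLow {S : TemporalSystem N n m} (hS : P.IsRealization S) :
    S.lowMatrix.rank ≤ P.grankLow := by
  have hbdd : BddAbove {r : ℕ | ∃ S : TemporalSystem N n m,
      P.IsRealization S ∧ r = S.lowMatrix.rank} := by
    refine ⟨n, ?_⟩
    rintro r ⟨S, -, rfl⟩
    simpa using S.lowMatrix.rank_le_card_height
  exact le_csSup hbdd ⟨S, hS, rfl⟩

theorem card_biUnion_le_grankLow (V : Fin N → Finset (Fin n))
    (hV : ∀ i, CoveredByCactus (P.digraph i) (V i)) :
    (Finset.univ.biUnion V).card ≤ P.grankLow := by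
  obtain ⟨S, hS, hli⟩ := P.exists_isRealization_linearIndepOn V hV
  exact hli.card_le_rank.trans (P.rank_le_grankLow hS)

end TemporalPattern

end

theorem proposition4 (N n : ℕ) (m : Fin N → ℕ) (P : TemporalPattern N n m)
    (V : Fin N → Finset (Fin n)) (hV : ∀ i : Fin N, CoveredByCactus (P.digraph i) (V i)) :
    (Finset.univ.biUnion V).card ≤ P.grankLow ∧ P.grankLow ≤ P.gdimReachable :=
  ⟨P.card_biUnion_le_grankLow V hV, P.grankLow_le_gdimReachable⟩
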